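/- Let $G$ be a countable discrete group. Call $G$ amenable if there is a left-invariant mean on $G$, i.e. a positive linear functional $\tau$ on $\ell^\infty(G)$ with $\tau(1)=1$ and $\tau(g\cdot f)=\tau(f)$ for all $g\in G$, $f\in\ell^\infty(G)$, where $(g\cdot f)(x)=f(g^{-1}x)$. For a complex Hilbert space $\mathcal H$, a map $\varphi\colon G\to B(\mathcal H)$ is uniformly bounded if $\sup_{x\in G}\|\varphi(x)\|<\infty$, and a map $\psi\colon G\to B(\mathcal H)$ is positive definite if $\sum_{i,j=1}^n\langle\psi(x_i^{-1}x_j)\xi_j,\xi_i\rangle\ge 0$ for all $n$, all $x_1,\dots,x_n\in G$ and all $\xi_1,\dots,\xi_n\in\mathcal H$ (the inner product being linear in its first argument). The following are equivalent: 1. $G$ is amenable; 2. for every separable complex Hilbert space $\mathcal H$ and every uniformly bounded map $\varphi\colon G\to B(\mathcal H)$, there exists a positive definite map $\psi\colon G\to B(\mathcal H)$ such that for every finite set $F\subset G$, every integer $n\ge 1$, and all functions $\xi_1,\dots,\xi_n,\zeta_1,\dots,\zeta_n\colon F\to\mathcal H$, there exists $y\in G$ such that $$\sum_{i=1}^n\sum_{x\in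 F}\|\varphi(xy)\varphi(y)^*\xi_i(x)-\psi(x)\xi_i(x)\|^2\le\sum_{i=1}^n\sum_{x\in F}\|\varphi(xy)\varphi(y)^*\xi_i(x)-\zeta_i(x)\|^2;$$ 3. the same condition as in 2, for every complex Hilbert space $\mathcal H$, separable or not. -/

import Mathlib

open scoped ENNReal ComplexOrder

universe u v

noncomputable section

/-- The space `ℓ^∞(G)` of bounded complex valued functions on `G`. -/
abbrev EllInfty (G : Type*) : Type _ := lp (fun _ : G => ℂ) ∞

/-- Left translation on `ℓ^∞(G)`: `(g • f)(x) = f (g⁻¹ x)`. -/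
def EllInfty.leftTranslate {G : Type*} [Group G] (g : G) (f : EllInfty G) : EllInfty G :=
  ⟨fun x => f (g⁻¹ * x), by
    obtain ⟨C, hC⟩ := memℓp_infty_iff.1 (lp.memℓp f)
    refine memℓp_infty_iff.2 ⟨C, ?_⟩
    rintro _ ⟨x, rfl⟩
    exact hC ⟨g⁻¹ * x, rfl⟩⟩

/-- A left invariant mean on `G`: a state (a positive unital linear functional) on `ℓ^∞(G)` which
is invariant under left translation. Positive linear functionals are automatically continuous. -/
structure IsLeftInvariantMean {G : Type*} [Group G] (τ : EllInfty G →ₗ[ℂ] ℂ) : Prop where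
  map_one : τ 1 = 1
  nonneg : ∀ f : EllInfty G, (∀ x, (0 : ℂ) ≤ f x) → 0 ≤ τ f
  invariant : ∀ (g : G) (f : EllInfty G), τ (EllInfty.leftTranslate g f) = τ f

/-- A discrete group is amenable if it has a left invariant mean. -/
def IsAmenableGroup (G : Type*) [Group G] : Prop :=
  ∃ τ : EllInfty G →ₗ[ℂ] ℂ, IsLeftInvariantMean τ

section Maps

variable {G : Type*} {H : Type*} [NormedAddCommGroup H] [InnerProductSpace ℂ H]

/-- A map `φ : G → B(H)` is uniformly bounded if `sup_x ‖φ(x)‖ < ∞`. -/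
def IsUniformlyBounded (φ : G → H →L[ℂ] H) : Prop :=
  ∃ C : ℝ, ∀ x, ‖φ x‖ ≤ C

/-- A map `ψ : G → B(H)` is positive definite if all the operator matrices `[ψ(xᵢ⁻¹ xⱼ)]ᵢⱼ` are
positive, i.e. `∑ᵢⱼ ⟨ψ(xᵢ⁻¹ xⱼ) ξⱼ, ξᵢ⟩ ≥ 0`; the inner product of Mathlib is linear in its second
argument. In the order of `ℂ`, `0 ≤ z` says that `z` is real and nonnegative. -/
def IsPositiveDefiniteMap [Group G] (ψ : G → H →L[ℂ] H) : Prop :=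
  ∀ (n : ℕ) (x : Fin n → G) (ξ : Fin n → H),
    0 ≤ ∑ i, ∑ j, inner ℂ (ξ i) (ψ ((x i)⁻¹ * x j) (ξ j))

end Maps

/-- The stability condition at a single Hilbert space `H`: every uniformly bounded map
`φ : G → B(H)` has a positive definite map `ψ : G → B(H)` satisfying the proximity inequalities
in the strong operator topology. -/
def StabilityCondition (G : Type*) [Group G] (H : Type*) [NormedAddCommGroup H]
    [InnerProductSpace ℂ H] [CompleteSpace H] : Prop :=
  ∀ φ : G → H →L[ℂ] H, IsUniformlyBounded φ →
    ∃ ψ : G → H →L[ℂ] H, IsPositiveDefiniteMap ψ ∧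
      ∀ (F : Finset G) (n : ℕ), 1 ≤ n → ∀ ξ ζ : Fin n → F → H,
        ∃ y : G,
          ∑ i, ∑ x : F,
              ‖φ (x * y) ((φ y).adjoint (ξ i x)) - ψ x (ξ i x)‖ ^ 2
            ≤ ∑ i, ∑ x : F,
              ‖φ (x * y) ((φ y).adjoint (ξ i x)) - ζ i x‖ ^ 2

end

/-! If `τ` is an invariant mean, let `ψ x` be the weak `τ`-average over `y` of `φ (x * y) (φ y)*`.
Invariance makes `ψ` positive definite, and a mean minimises the average squared distance, which
gives the proximity inequality (`stabilityCondition_of_isLeftInvariantMean`). Conversely, proximity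
forces `ψ` to be weakly approximated by convex combinations of these operators
(`exists_re_sum_inner_le_of_proximity`). For a rank-one `φ` encoding bounded functions `u i`, two
matrix coefficients of `φ (x * y) (φ y)*` are a translate of `u i` and the conjugate of `u i`.
Positive definiteness ties the corresponding coefficients of `ψ` together, so no sum of differences
of translates is uniformly negative; Hahn–Banach then yields the mean. -/

section Means

/-! ### Calculus of means on bounded functions. -/

variable {G : Type*}

/-- The value of a linear functional on `ℓ^∞(G)` at a function on `G`, zero if the function is
not bounded. -/
noncomputable def meanValue (τ : EllInfty G →ₗ[ℂ] ℂ) (f : G → ℂ) : ℂ :=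
  open Classical in if h : Memℓp f ∞ then τ ⟨f, h⟩ else 0

theorem memℓp_infty_of_norm_le {f : G → ℂ} {C : ℝ} (h : ∀ y, ‖f y‖ ≤ C) :
    Memℓp (E := fun _ : G => ℂ) f ∞ :=
  memℓp_infty ⟨C, by rintro _ ⟨y, rfl⟩; exact h y⟩

theorem exists_norm_le_of_memℓp_infty {f : G → ℂ} (h : Memℓp f ∞) : ∃ C : ℝ, ∀ y, ‖f y‖ ≤ C := by
  obtain ⟨C, hC⟩ := memℓp_infty_iff.1 h
  exact ⟨C, fun y => hC ⟨y, rfl⟩⟩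

theorem memℓp_infty_const_mul {f : G → ℂ} (c : ℂ) (h : Memℓp f ∞) :
    Memℓp (fun y => c * f y) ∞ :=
  h.const_smul c

variable (τ : EllInfty G →ₗ[ℂ] ℂ)

theorem meanValue_eq {f : G → ℂ} (h : Memℓp f ∞) : meanValue τ f = τ ⟨f, h⟩ :=
  dif_pos h

theorem meanValue_add {f g : G → ℂ} (hf : Memℓp f ∞) (hg : Memℓp g ∞) :
    meanValue τ (fun y => f y + g y) = meanValue τ f + meanValue τ g := by
  have h : Memℓp (fun y => f y + g y) ∞ := hf.add hg
  rw [meanValue_eq τ hf, meanValue_eq τ hg, meanValue_eq τ h, ← map_add]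
  rfl

theorem meanValue_const_mul {f : G → ℂ} (c : ℂ) (hf : Memℓp f ∞) :
    meanValue τ (fun y => c * f y) = c * meanValue τ f := by
  have h : Memℓp (fun y => c * f y) ∞ := hf.const_smul c
  rw [meanValue_eq τ hf, meanValue_eq τ h, ← smul_eq_mul, ← map_smul]
  rfl

theorem memℓp_infty_sum {ι : Type*} (s : Finset ι) {f : ι → G → ℂ} (hf : ∀ i, Memℓp (f i) ∞) :
    Memℓp (fun y => ∑ i ∈ s, f i y) ∞ :=
  Memℓp.finsetSum s fun i _ => hf i

theorem meanValue_sum {ι : Type*} (s : Finset ι) {f : ι → G → ℂ} (hf : ∀ i, Memℓp (f i) ∞) :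
    meanValue τ (fun y => ∑ i ∈ s, f i y) = ∑ i ∈ s, meanValue τ (f i) := by
  classical
  induction s using Finset.induction_on with
  | empty =>
    simpa using meanValue_const_mul τ 0 (memℓp_infty_of_norm_le (C := 1) (f := 1) (by simp))
  | insert a s ha ih =>
    simp only [Finset.sum_insert ha]
    rw [meanValue_add τ (hf a) (memℓp_infty_sum s hf), ih]

theorem meanValue_re_add_im {f : G → ℂ} {C : ℝ} (h : ∀ y, ‖f y‖ ≤ C) :
    meanValue τ f = meanValue τ (fun y => ((f y).re : ℂ))
      + Complex.I * meanValue τ (fun y => ((f y).im : ℂ)) := by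
  have hr : Memℓp (fun y => ((f y).re : ℂ)) ∞ := memℓp_infty_of_norm_le (C := C) fun y => by
    simpa using (Complex.abs_re_le_norm _).trans (h y)
  have hi : Memℓp (fun y => ((f y).im : ℂ)) ∞ := memℓp_infty_of_norm_le (C := C) fun y => by
    simpa using (Complex.abs_im_le_norm _).trans (h y)
  rw [← meanValue_const_mul τ _ hi, ← meanValue_add τ hr (memℓp_infty_const_mul Complex.I hi)]
  congr 1
  ext y
  rw [mul_comm, Complex.re_add_im]

variable {τ} [Group G] (hτ : IsLeftInvariantMean τ)
include hτ

theorem meanValue_const (c : ℂ) : meanValue τ (fun _ => c) = c := by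
  have h := meanValue_const_mul τ c
    (memℓp_infty_of_norm_le (C := 1) (f := fun _ : G => 1) (by simp))
  have h1 : meanValue τ (fun _ => 1) = 1 := by
    rw [meanValue_eq τ (memℓp_infty_of_norm_le (C := 1) (by simp))]
    exact hτ.map_one
  simpa [h1] using h

theorem meanValue_nonneg {f : G → ℂ} (hf : Memℓp f ∞) (h : ∀ y, 0 ≤ f y) :
    0 ≤ meanValue τ f := by
  rw [meanValue_eq τ hf]
  exact hτ.nonneg _ h

theorem meanValue_translate (g : G) {f : G → ℂ} (hf : Memℓp f ∞) :
    meanValue τ (fun y => f (g⁻¹ * y)) = meanValue τ f := by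
  obtain ⟨C, hC⟩ := exists_norm_le_of_memℓp_infty hf
  have h : Memℓp (fun y => f (g⁻¹ * y)) ∞ := memℓp_infty_of_norm_le fun y => hC _
  rw [meanValue_eq τ hf, meanValue_eq τ h]
  exact hτ.invariant g ⟨f, hf⟩

theorem meanValue_ofReal {f : G → ℝ} {C : ℝ} (h : ∀ y, |f y| ≤ C) :
    (meanValue τ (fun y => (f y : ℂ))).im = 0 ∧ |(meanValue τ (fun y => (f y : ℂ))).re| ≤ C := by
  have hf : Memℓp (fun y => (f y : ℂ)) ∞ := memℓp_infty_of_norm_le (C := C) (by simpa using h)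
  have hc : Memℓp (fun _ : G => (C : ℂ)) ∞ := memℓp_infty_of_norm_le (C := |C|) (by simp)
  have h1 : 0 ≤ meanValue τ (fun y => (C : ℂ) + (f y : ℂ)) :=
    meanValue_nonneg hτ (hc.add hf) fun y => by
      exact_mod_cast (by linarith [neg_le_of_abs_le (h y)] : 0 ≤ C + f y)
  have h2 : 0 ≤ meanValue τ (fun y => (C : ℂ) + (-1) * (f y : ℂ)) :=
    meanValue_nonneg hτ (hc.add (memℓp_infty_const_mul (-1) hf)) fun y => by
      exact_mod_cast (by linarith [le_of_abs_le (h y)] : 0 ≤ C + (-1) * f y)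
  rw [meanValue_add τ hc hf, meanValue_const hτ] at h1
  rw [meanValue_add τ hc (memℓp_infty_const_mul (-1) hf), meanValue_const hτ,
    meanValue_const_mul τ _ hf] at h2
  rw [Complex.nonneg_iff] at h1 h2
  simp at h1 h2
  refine ⟨h1.2.symm, abs_le.2 ⟨by linarith, by linarith⟩⟩

theorem meanValue_re {f : G → ℂ} (hf : Memℓp f ∞) :
    meanValue τ (fun y => ((f y).re : ℂ)) = ((meanValue τ f).re : ℂ) := by
  obtain ⟨C, h⟩ := exists_norm_le_of_memℓp_infty hf
  have hr := meanValue_ofReal hτ (f := fun y => (f y).re) fun y =>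
    (Complex.abs_re_le_norm _).trans (h y)
  have hi := meanValue_ofReal hτ (f := fun y => (f y).im) fun y =>
    (Complex.abs_im_le_norm _).trans (h y)
  rw [meanValue_re_add_im τ h]
  apply Complex.ext <;> simp [hr.1, hi.1]

/-- The factor 2 comes from bounding real and imaginary parts separately; it suffices for continuity
of the averaged form. -/
theorem norm_meanValue_le {f : G → ℂ} {C : ℝ} (h : ∀ y, ‖f y‖ ≤ C) :
    ‖meanValue τ f‖ ≤ 2 * C := by
  have hr := meanValue_ofReal hτ (f := fun y => (f y).re) fun y =>
    (Complex.abs_re_le_norm _).trans (h y)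
  have hi := meanValue_ofReal hτ (f := fun y => (f y).im) fun y =>
    (Complex.abs_im_le_norm _).trans (h y)
  refine (Complex.norm_le_abs_re_add_abs_im _).trans ?_
  rw [meanValue_re_add_im τ h]
  simp [hr.1, hi.1]
  linarith [hr.2, hi.2]

/-! ### Averaging operators: amenability gives stability. -/

/-- Bounded operator families have a weak mean. -/
theorem exists_weak_mean {H : Type*} [NormedAddCommGroup H] [InnerProductSpace ℂ H]
    [CompleteSpace H] {T : G → H →L[ℂ] H} {C : ℝ} (hT : ∀ y, ‖T y‖ ≤ C) :
    ∃ S : H →L[ℂ] H, ∀ a b, inner ℂ a (S b) = meanValue τ fun y => inner ℂ a (T y b) := by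
  have hb (a b : H) (y : G) : ‖inner ℂ a (T y b)‖ ≤ C * ‖a‖ * ‖b‖ := by
    calc ‖inner ℂ a (T y b)‖ ≤ ‖a‖ * ‖T y b‖ := norm_inner_le_norm _ _
      _ ≤ ‖a‖ * (C * ‖b‖) := by gcongr; exact (T y).le_of_opNorm_le (hT y) b
      _ = C * ‖a‖ * ‖b‖ := by ring
  have hm (a b : H) : Memℓp (fun y => inner ℂ a (T y b)) ∞ := memℓp_infty_of_norm_le (hb a b)
  let B : H →ₗ⋆[ℂ] H →ₗ[ℂ] ℂ := LinearMap.mk₂'ₛₗ (starRingEnd ℂ) (RingHom.id ℂ)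
    (fun a b => meanValue τ fun y => inner ℂ a (T y b))
    (fun a a' b => by simp only [inner_add_left]; exact meanValue_add τ (hm _ _) (hm _ _))
    (fun c a b => by simp only [inner_smul_left]; exact meanValue_const_mul τ _ (hm _ _))
    (fun a b b' => by
      simp only [map_add, inner_add_right]; exact meanValue_add τ (hm _ _) (hm _ _))
    (fun c a b => by
      simp only [map_smul, inner_smul_right]; exact meanValue_const_mul τ _ (hm _ _))
  let B' : H →L⋆[ℂ] H →L[ℂ] ℂ := B.mkContinuous₂ (2 * C) fun a b =>
    (norm_meanValue_le hτ (hb a b)).trans_eq (by ring)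
  refine ⟨(InnerProductSpace.continuousLinearMapOfBilin B').adjoint, fun a b => ?_⟩
  rw [ContinuousLinearMap.adjoint_inner_right,
    InnerProductSpace.continuousLinearMapOfBilin_apply]
  rfl

theorem stabilityCondition_of_isLeftInvariantMean (H : Type*) [NormedAddCommGroup H]
    [InnerProductSpace ℂ H] [CompleteSpace H] : StabilityCondition G H := by
  rintro φ ⟨C, hC⟩
  have hC0 : 0 ≤ C := (norm_nonneg _).trans (hC 1)
  have hA (x y : G) : ‖φ x ∘L (φ y).adjoint‖ ≤ C * C := by
    refine (ContinuousLinearMap.opNorm_comp_le _ _).trans ?_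
    rw [LinearIsometryEquiv.norm_map]
    exact mul_le_mul (hC _) (hC _) (norm_nonneg _) hC0
  have hm (x z : G) (a b : H) :
      Memℓp (fun y => inner ℂ a (φ (x * y) ((φ (z * y)).adjoint b))) ∞ :=
    memℓp_infty_of_norm_le (C := ‖a‖ * (C * C * ‖b‖)) fun y =>
      (norm_inner_le_norm _ _).trans <| by
        gcongr
        exact (φ (x * y) ∘L (φ (z * y)).adjoint).le_of_opNorm_le (hA _ _) b
  have hm1 (x : G) (a b : H) : Memℓp (fun y => inner ℂ a (φ (x * y) ((φ y).adjoint b))) ∞ := by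
    simpa using hm x 1 a b
  choose ψ hψ using fun x : G =>
    exists_weak_mean hτ (T := fun y => φ (x * y) ∘L (φ y).adjoint) fun y => hA _ _
  simp only [ContinuousLinearMap.comp_apply] at hψ
  refine ⟨ψ, fun n x ξ => ?_, fun F n hn ξ ζ => ?_⟩
  · have h (i j : Fin n) : inner ℂ (ξ i) (ψ ((x i)⁻¹ * x j) (ξ j)) = meanValue τ fun y =>
        inner ℂ (ξ i) (φ ((x i)⁻¹ * y) ((φ ((x j)⁻¹ * y)).adjoint (ξ j))) := by
      -- Translating by `x j` makes the double sum the mean of a squared norm.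
      rw [hψ, ← meanValue_translate hτ (x j) (hm1 _ _ _)]
      simp [mul_assoc]
    simp only [h]
    simp only [← meanValue_sum τ Finset.univ fun j => hm _ _ _ _]
    rw [← meanValue_sum τ Finset.univ fun i => memℓp_infty_sum _ fun j => hm _ _ _ _]
    refine meanValue_nonneg hτ (memℓp_infty_sum _ fun i => memℓp_infty_sum _ fun j => hm _ _ _ _)
      fun y => ?_
    have : ∑ i, ∑ j, inner ℂ (ξ i) (φ ((x i)⁻¹ * y) ((φ ((x j)⁻¹ * y)).adjoint (ξ j)))
        = inner ℂ (∑ i, (φ ((x i)⁻¹ * y)).adjoint (ξ i)) (∑ j, (φ ((x j)⁻¹ * y)).adjoint (ξ j)) := by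
      simp only [sum_inner, inner_sum, ContinuousLinearMap.adjoint_inner_left]
      rw [Finset.sum_comm]
    rw [this, inner_self_eq_norm_sq_to_K]
    refine Complex.nonneg_iff.2 ?_
    norm_cast
    exact ⟨sq_nonneg _, rfl⟩
  · by_contra! hlt
    let w (p : Fin n × F) : H := ψ p.2 (ξ p.1 p.2) - ζ p.1 p.2
    let A (y : G) (p : Fin n × F) : H := φ (p.2 * y) ((φ y).adjoint (ξ p.1 p.2))
    -- The part depending on `y` has mean zero, so the mean of the total difference is `-∑ ‖w p‖ ^
    -- 2`. Positivity for every `y` forces `w = 0`, and then the difference vanishes: a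
    -- contradiction.
    have hexp (y : G) (p : Fin n × F) :
        ‖A y p - ψ p.2 (ξ p.1 p.2)‖ ^ 2 - ‖A y p - ζ p.1 p.2‖ ^ 2
          = (2 * (inner ℂ (w p) (ψ p.2 (ξ p.1 p.2)) - inner ℂ (w p) (A y p)) : ℂ).re
            - ‖w p‖ ^ 2 := by
      have : A y p - ζ p.1 p.2 = (A y p - ψ p.2 (ξ p.1 p.2)) + w p := by simp [w]
      rw [this, @norm_add_sq ℂ, ← inner_sub_right, inner_re_symm,
        ← neg_sub (A y p) (ψ p.2 (ξ p.1 p.2)), inner_neg_right]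
      simp
      ring
    let f (p : Fin n × F) (y : G) : ℂ :=
      2 * inner ℂ (w p) (ψ p.2 (ξ p.1 p.2)) + (-2) * inner ℂ (w p) (A y p)
    have hmA (p : Fin n × F) : Memℓp (fun y => inner ℂ (w p) (A y p)) ∞ := hm1 _ _ _
    have hmc (c : ℂ) : Memℓp (fun _ : G => c) ∞ := memℓp_infty_of_norm_le fun _ => le_rfl
    have hmf (p : Fin n × F) : Memℓp (f p) ∞ := (hmc _).add (memℓp_infty_const_mul (-2) (hmA p))
    have hf0 (p : Fin n × F) : meanValue τ (f p) = 0 := by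
      rw [meanValue_add τ (hmc _) (memℓp_infty_const_mul (-2) (hmA p)), meanValue_const hτ,
        meanValue_const_mul τ _ (hmA p), ← hψ]
      ring
    have hdiff (y : G) : 0 < (∑ p, f p y).re - ∑ p, ‖w p‖ ^ 2 := by
      have h := hlt y
      rw [← Fintype.sum_prod_type', ← Fintype.sum_prod_type', ← sub_pos,
        ← Finset.sum_sub_distrib] at h
      rw [Complex.re_sum, ← Finset.sum_sub_distrib]
      refine h.trans_eq (Finset.sum_congr rfl fun p _ => (hexp y p).trans ?_)
      simp only [f]
      congr 2
      ring
    have hms := memℓp_infty_sum Finset.univ hmf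
    have hre : Memℓp (fun y => ((∑ p, f p y).re : ℂ)) ∞ := by
      obtain ⟨K, hK⟩ := exists_norm_le_of_memℓp_infty hms
      exact memℓp_infty_of_norm_le (C := K) fun y => by
        simpa only [Complex.norm_real, Real.norm_eq_abs] using
          (Complex.abs_re_le_norm _).trans (hK y)
    have hpos : 0 ≤ meanValue τ
        (fun y => ((∑ p, f p y).re : ℂ) + ((-∑ p, ‖w p‖ ^ 2 : ℝ) : ℂ)) :=
      meanValue_nonneg hτ (hre.add (hmc _)) fun y => by
        rw [← Complex.ofReal_add]
        exact Complex.zero_le_real.2 (by linarith [hdiff y])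
    rw [meanValue_add τ hre (hmc _), meanValue_const hτ, meanValue_re hτ hms,
      meanValue_sum τ _ hmf] at hpos
    simp only [hf0, Finset.sum_const_zero, Complex.zero_re, Complex.ofReal_zero, zero_add,
      Complex.zero_le_real] at hpos
    have hw0 (p : Fin n × F) : w p = 0 := by
      have h0 : ∑ p, ‖w p‖ ^ 2 = 0 :=
        le_antisymm (by linarith) (Finset.sum_nonneg fun _ _ => sq_nonneg _)
      have := (Finset.sum_eq_zero_iff_of_nonneg fun _ _ => sq_nonneg _).1 h0 p (Finset.mem_univ p)
      simpa using this
    have := hdiff 1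
    simp [f, hw0] at this

end Means

/-! ### From stability to an invariant mean. -/

section Converse

/-- The form at the points `1, g` is real; replacing `b` by `I • b` turns imaginary parts into real
ones. -/
theorem IsPositiveDefiniteMap.re_inner_inv {G : Type*} [Group G] {H : Type*}
    [NormedAddCommGroup H] [InnerProductSpace ℂ H] {ψ : G → H →L[ℂ] H}
    (h : IsPositiveDefiniteMap ψ) (g : G) (a b : H) :
    (inner ℂ a (ψ g b)).re = (inner ℂ b (ψ g⁻¹ a)).re := by
  have h1 (a : H) : (inner ℂ a (ψ 1 a)).im = 0 := by
    have := (Complex.nonneg_iff.1 (h 1 (fun _ => 1) (fun _ => a))).2.symm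
    simpa using this
  have h2 (b : H) : (inner ℂ a (ψ g b)).im + (inner ℂ b (ψ g⁻¹ a)).im = 0 := by
    have := (Complex.nonneg_iff.1 (h 2 ![1, g] ![a, b])).2.symm
    simpa [Fin.sum_univ_two, h1] using this
  have h3 := h2 (Complex.I • b)
  simp at h3
  linarith

/-- The proximity inequalities put `ψ` in the weak closure of the convex hull of the orbit of
operators `φ (x * y) (φ y)*`. -/
theorem exists_re_sum_inner_le_of_proximity {G : Type*} [Group G] {H : Type*}
    [NormedAddCommGroup H] [InnerProductSpace ℂ H] [CompleteSpace H] {φ ψ : G → H →L[ℂ] H}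
    (hψ : ∀ (F : Finset G) (n : ℕ), 1 ≤ n → ∀ ξ ζ : Fin n → F → H,
        ∃ y : G,
          ∑ i, ∑ x : F,
              ‖φ (x * y) ((φ y).adjoint (ξ i x)) - ψ x (ξ i x)‖ ^ 2
            ≤ ∑ i, ∑ x : F,
              ‖φ (x * y) ((φ y).adjoint (ξ i x)) - ζ i x‖ ^ 2)
    {n : ℕ} (hn : 1 ≤ n) (x : Fin n → G) (ξ η : Fin n → H) {ε : ℝ} (hε : 0 < ε) :
    ∃ y : G, ∑ i, (inner ℂ (η i)
      (φ (x i * y) ((φ y).adjoint (ξ i)) - ψ (x i) (ξ i))).re ≤ ε := by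
  classical
  let K : ℝ := ∑ i, ‖η i‖ ^ 2
  have hK : 0 ≤ K := Finset.sum_nonneg fun _ _ => sq_nonneg _
  let t : ℝ := ε / (K + 1)
  have ht : 0 < t := by positivity
  have htK : t * K ≤ ε := by
    rw [div_mul_eq_mul_div, div_le_iff₀ (by positivity)]
    nlinarith
  -- Perturb `ψ` by `t • η i`, only at `x i`. The squared norms cancel; dividing by `t` leaves an
  -- error `t * K ≤ ε`.
  obtain ⟨y, hy⟩ := hψ (Finset.univ.image x) n hn (fun i _ => ξ i)
    (fun i z => ψ z (ξ i) + if (z : G) = x i then (t : ℂ) • η i else 0)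
  refine ⟨y, ?_⟩
  let B (i : Fin n) (z : G) : H := φ (z * y) ((φ y).adjoint (ξ i)) - ψ z (ξ i)
  have hexp (i : Fin n) (z : G) :
      ‖φ (z * y) ((φ y).adjoint (ξ i)) - (ψ z (ξ i) + if z = x i then (t : ℂ) • η i else 0)‖ ^ 2
        = ‖B i z‖ ^ 2 + if z = x i then t ^ 2 * ‖η i‖ ^ 2 - 2 * t * (inner ℂ (η i) (B i z)).re
          else 0 := by
    rw [← sub_sub]
    split_ifs
    · rw [@norm_sub_sq ℂ, inner_re_symm, inner_smul_left, norm_smul]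
      simp [B, inner_sub_right, mul_pow, sq_abs]
      ring
    · simp [B]
  have hsum (i : Fin n) : ∑ z : (Finset.univ.image x : Finset G), (if (z : G) = x i then
      t ^ 2 * ‖η i‖ ^ 2 - 2 * t * (inner ℂ (η i) (B i z)).re else 0)
      = t ^ 2 * ‖η i‖ ^ 2 - 2 * t * (inner ℂ (η i) (B i (x i))).re := by
    rw [Finset.sum_coe_sort (Finset.univ.image x) fun z => if z = x i then
      t ^ 2 * ‖η i‖ ^ 2 - 2 * t * (inner ℂ (η i) (B i z)).re else 0, Finset.sum_ite_eq']
    simp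
  simp only [hexp, Finset.sum_add_distrib, hsum] at hy
  rw [Finset.sum_sub_distrib, ← Finset.mul_sum, ← Finset.mul_sum] at hy
  have h : 2 * t * ∑ i, (inner ℂ (η i) (B i (x i))).re ≤ t ^ 2 * K := by linarith
  have h' : ∑ i, (inner ℂ (η i) (B i (x i))).re * 2 ≤ t * K := by
    rw [← Finset.sum_mul]
    refine le_of_mul_le_mul_left ?_ ht
    linarith
  rw [← Finset.sum_mul] at h'
  change ∑ i, (inner ℂ (η i) (B i (x i))).re ≤ ε
  linarith

/-- Under the stability condition on finite dimensional spaces, no sum of differences of bounded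
functions and their translates is uniformly negative. -/
theorem exists_lt_re_sum_translate_sub {G : Type*} [Group G]
    (h : ∀ (H : Type v) [NormedAddCommGroup H] [InnerProductSpace ℂ H] [CompleteSpace H]
        [TopologicalSpace.SeparableSpace H], StabilityCondition G H)
    {n : ℕ} (g : Fin n → G) (u : Fin n → EllInfty G) {ε : ℝ} (hε : 0 < ε) :
    ∃ y : G, -ε < ∑ i, (u i ((g i)⁻¹ * y) - u i y).re := by
  rcases Nat.eq_zero_or_pos n with rfl | hn
  · exact ⟨1, by simpa using hε⟩
  let ι := ULift.{v} (Option (Fin n))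
  let e (i : ι) : EuclideanSpace ℂ ι := EuclideanSpace.single i 1
  let o : ι := ⟨none⟩
  let s (i : Fin n) : ι := ⟨some i⟩
  let v (y : G) : EuclideanSpace ℂ ι := e o + ∑ i, u i y • e (s i)
  let φ (y : G) : EuclideanSpace ℂ ι →L[ℂ] EuclideanSpace ℂ ι :=
    InnerProductSpace.rankOne ℂ (v y) (e o)
  have he (i : ι) : ‖e i‖ = 1 := by simp [e]
  have hee (i j : ι) : inner ℂ (e i) (e j) = if i = j then 1 else 0 :=
    orthonormal_iff_ite.1 EuclideanSpace.orthonormal_single i j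
  have hoo : inner ℂ (e o) (e o) = 1 := by simp [hee]
  have hos (i : Fin n) : inner ℂ (e o) (e (s i)) = 0 := by
    rw [hee, if_neg fun h => by cases congrArg ULift.down h]
  have hso (i : Fin n) : inner ℂ (e (s i)) (e o) = 0 := by
    rw [hee, if_neg fun h => by cases congrArg ULift.down h]
  have hss (i j : Fin n) : inner ℂ (e (s i)) (e (s j)) = if i = j then 1 else 0 := by
    rw [hee]
    exact if_congr (ULift.up_injective.comp (Option.some_injective _)).eq_iff rfl rfl
  have hvo (y : G) : inner ℂ (e o) (v y) = 1 := by
    simp [v, hoo, hos]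
  have hvs (y : G) (i : Fin n) : inner ℂ (e (s i)) (v y) = u i y := by
    simp [v, hso, hss]
  have hφ (x y : G) (a b : EuclideanSpace ℂ ι) :
      inner ℂ a (φ x ((φ y).adjoint b)) = inner ℂ a (v x) * inner ℂ (v y) b := by
    simp [φ, he, InnerProductSpace.adjoint_rankOne, mul_comm]
  have hb : IsUniformlyBounded φ := by
    refine ⟨1 + ∑ i, ‖u i‖, fun y => ?_⟩
    simp only [φ, InnerProductSpace.norm_rankOne, he, mul_one]
    refine (norm_add_le _ _).trans ?_
    rw [he]
    gcongr
    refine norm_sum_le_of_le _ fun i _ => ?_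
    rw [norm_smul, he, mul_one]
    exact lp.norm_apply_le_norm (by simp) (u i) y
  obtain ⟨ψ, hpd, hψ⟩ := h (EuclideanSpace ℂ ι) φ hb
  -- One `y` must serve both families, at `g i` and at its inverse. The sign of `-e (s i)` makes the
  -- `ψ` terms cancel, and `ε / 2` gives the strict inequality.
  obtain ⟨y, hy⟩ := exists_re_sum_inner_le_of_proximity hψ (n := n + n) (by omega)
    (Fin.append (fun i => g i) (fun i => (g i)⁻¹)) (Fin.append (fun i => e (s i)) (fun _ => e o))
    (Fin.append (fun _ => e o) (fun i => -e (s i))) (half_pos hε)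
  refine ⟨y, ?_⟩
  simp only [Fin.sum_univ_add, Fin.append_left, Fin.append_right, inner_sub_right, inner_neg_left,
    hφ, hvo, hvs, Complex.sub_re, Complex.neg_re, ← inner_conj_symm (v y), map_one, mul_one, one_mul,
    Complex.conj_re, hpd.re_inner_inv (g _) (e o) (e (s _))] at hy
  rw [← Finset.sum_add_distrib] at hy
  have : ∑ i, (u i ((g i)⁻¹ * y) - u i y).re = -∑ i, ((u i y).re
      - (inner ℂ (e (s i)) (ψ (g i)⁻¹ (e o))).re + (-(u i ((g i)⁻¹ * y)).re
      - -(inner ℂ (e (s i)) (ψ (g i)⁻¹ (e o))).re)) := by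
    rw [← Finset.sum_neg_distrib]
    refine Finset.sum_congr rfl fun i _ => ?_
    rw [Complex.sub_re]
    ring
  linarith

theorem EllInfty.bddAbove_re {G : Type*} (f : EllInfty G) :
    BddAbove (Set.range fun x => (f x).re) := by
  refine ⟨‖f‖, ?_⟩
  rintro _ ⟨x, rfl⟩
  exact (Complex.re_le_norm _).trans (lp.norm_apply_le_norm (by simp) f x)

/-- The Hahn–Banach criterion for amenability. -/
theorem isAmenableGroup_of_forall_exists_lt {G : Type*} [Group G]
    (h : ∀ (n : ℕ) (g : Fin n → G) (u : Fin n → EllInfty G) (ε : ℝ), 0 < ε →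
      ∃ y : G, -ε < ∑ i, (u i ((g i)⁻¹ * y) - u i y).re) :
    IsAmenableGroup G := by
  let N (f : EllInfty G) : ℝ := ⨆ x, (f x).re
  have hle (f : EllInfty G) (x : G) : (f x).re ≤ N f := le_ciSup f.bddAbove_re x
  let D : Submodule ℝ (EllInfty G) :=
    Submodule.span ℝ {d | ∃ (g : G) (f : EllInfty G), d = EllInfty.leftTranslate g f - f}
  have hD (d : EllInfty G) (hd : d ∈ D) : 0 ≤ N d := by
    obtain ⟨n, c, d', rfl⟩ := Submodule.mem_span_set'.1 hd
    choose g f hgf using fun i => (d' i).2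
    refine le_of_forall_pos_le_add fun ε hε => ?_
    obtain ⟨y, hy⟩ := h n g (fun i => c i • f i) ε hε
    have h1 := hle (∑ i, c i • (d' i : EllInfty G)) y
    have h2 : ((∑ i, c i • (d' i : EllInfty G) : EllInfty G) y).re
        = ∑ i, ((c i • f i) ((g i)⁻¹ * y) - (c i • f i) y).re := by
      rw [lp.coeFn_sum, Finset.sum_apply, Complex.re_sum]
      refine Finset.sum_congr rfl fun i _ => ?_
      rw [hgf i, smul_sub]
      rfl
    linarith
  -- Vanishing on `D` encodes invariance; domination by `N` yields positivity and normalisation.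
  obtain ⟨m, hm0, hmN⟩ := exists_extension_of_le_sublinear (⟨D, 0⟩ : EllInfty G →ₗ.[ℝ] ℝ) N
    (fun c hc f => by
      simp only [N, Real.mul_iSup_of_nonneg hc.le]
      congr 1
      ext x
      simp)
    (fun f f' => ciSup_le fun x => by
      simpa using add_le_add (hle f x) (hle f' x))
    (fun d => by simpa using hD d d.2)
  have hmle {f : EllInfty G} {c : ℝ} (hf : ∀ x, (f x).re ≤ c) : m f ≤ c :=
    (hmN f).trans (ciSup_le hf)
  have hm0' (f : EllInfty G) (hf : ∀ x, (f x).re = 0) : m f = 0 := by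
    have h1 := hmle (f := f) (c := 0) fun x => (hf x).le
    have h2 := hmle (f := -f) (c := 0) fun x => by simp [hf x]
    rw [map_neg] at h2
    linarith
  have hinv (g : G) (f : EllInfty G) : m (EllInfty.leftTranslate g f) = m f := by
    have := hm0 ⟨_, Submodule.subset_span ⟨g, f, rfl⟩⟩
    rw [map_sub] at this
    exact sub_eq_zero.1 this
  let τ : EllInfty G →ₗ[ℂ] ℂ := Module.Dual.extendRCLike m
  have hτ (f : EllInfty G) : τ f = (m f : ℂ) - Complex.I * (m (Complex.I • f) : ℂ) :=
    Module.Dual.extendRCLike_apply m f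
  refine ⟨τ, ?_, fun f hf => ?_, fun g f => ?_⟩
  · have h1 := hmle (f := 1) (c := 1) fun x => by simp
    have h2 := hmle (f := -1) (c := -1) fun x => by
      rw [lp.coeFn_neg, Pi.neg_apply]
      simp
    rw [map_neg] at h2
    rw [hτ, hm0' (Complex.I • 1) (by simp), le_antisymm h1 (by linarith)]
    simp
  · have h1 := hmle (f := -f) (c := 0) fun x => by
      simpa using (Complex.nonneg_iff.1 (hf x)).1
    rw [map_neg] at h1
    rw [hτ, hm0' (Complex.I • f) fun x => by simp [← (Complex.nonneg_iff.1 (hf x)).2]]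
    simpa using h1
  · have : Complex.I • EllInfty.leftTranslate g f = EllInfty.leftTranslate g (Complex.I • f) := rfl
    rw [hτ, hτ, this, hinv, hinv]

end Converse

/-- A countable discrete group is amenable if and only if the stability condition holds for every
separable Hilbert space, and if and only if it holds for every Hilbert space. -/
theorem mainTheorem1 (G : Type u) [Group G] [Countable G] :
    List.TFAE [
      IsAmenableGroup G,
      ∀ (H : Type v) [NormedAddCommGroup H] [InnerProductSpace ℂ H] [CompleteSpace H]
        [TopologicalSpace.SeparableSpace H], StabilityCondition G H,
      ∀ (H : Type v) [NormedAddCommGroup H] [InnerProductSpace ℂ H] [CompleteSpace H],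
        StabilityCondition G H] := by
  tfae_have 1 → 3
  | ⟨_, hτ⟩, H, _, _, _ => stabilityCondition_of_isLeftInvariantMean hτ H
  tfae_have 3 → 2
  | h, H, _, _, _, _ => h H
  tfae_have 2 → 1
  | h => isAmenableGroup_of_forall_exists_lt fun _ g u _ hε =>
      exists_lt_re_sum_translate_sub h g u hε
  tfae_finish
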